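/- Let $(\Omega,\mathcal F,\mu)$ be a $\sigma$-finite measure space and, for $i=0,1$, let $p_i':\Omega\to[0,\infty]$ and $p_i'':\Omega\to[0,\infty]$ be measurable with $p_i'\le p_i''$ a.e. and $\int p_i'\,d\mu\le 1\le\int p_i''\,d\mu$ (possibly $p_i''=\infty$ or $\int p_i''\,d\mu=\infty$). Let $\mathcal P_i$ be the set of probability measures $P_i$ on $\Omega$ with a density $p_i$ with respect to $\mu$ such that $p_i'\le p_i\le p_i''$ a.e. A pair $(Q_0,Q_1)\in\mathcal P_0\times\mathcal P_1$ with densities $(q_0,q_1)$ is called *least favorable* (in the sense of stochastic dominance) if there is a measurable version $z:\Omega\to[0,\infty]$ of the likelihood ratio, i.e. $z=q_1/q_0$ a.e. on $\{q_0+q_1>0\}$ (with $a/0=\infty$ for $a>0$), such that $$Q_0[z>\eta]\ \ge\ P_0[z>\eta]\quad\text{and}\quad Q_1[z\le\eta]\ \ge\ P_1[z\le\eta]\qquad\text{for all }(P_0,P_1)\in\mathcal P_0\times\mathcal P_1,\ \eta\ge 0 .$$ (1) Let $(Q_0,Q_1)\in\mathcal P_0\times\mathcal P_1$ have densities that satisfy,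 for some $\alpha\ge 0$ and some real $c_0,c_1\in(0,1/\alpha]$ (where $1/0=\infty$), $$q_0=\min\{p_0'',\max\{c_0(\alpha q_0+q_1),\,p_0'\}\},\qquad q_1=\min\{p_1'',\max\{c_1(q_0+\alpha q_1),\,p_1'\}\}\qquad\text{a.e.}\tag{$*$}$$ Then, with $D=\{q_0+q_1>0\}$, for all $(P_0,P_1)\in\mathcal P_0\times\mathcal P_1$ and all $\eta\ge0$, $$Q_0\big[D,\ \tfrac{q_1}{q_0}>\eta\big]\ \ge\ P_0\big[D,\ \tfrac{q_1}{q_0}>\eta\big]\quad\text{and}\quad Q_1\big[D,\ \tfrac{q_1}{q_0}\le\eta\big]\ \ge\ P_1\big[D,\ \tfrac{q_1}{q_0}\le\eta\big].$$ Moreover, $(Q_0,Q_1)$ is least favorable provided that (N) $c_0c_1\le(1-\alpha c_0)(1-\alpha c_1)$, or $q_0+q_1>0$ at almost every point where $p_0''>0$ and $p_1''>0$. (2) If, for each $i\in\{0,1\}$, $\int p_i'\,d\mu<1$ or $p_i'=p_i''$ a.e., then there exist $(Q_0,Q_1)\in\mathcal P_0\times\mathcal P_1$, $\alpha\ge0$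 and real $c_0,c_1\in(0,1/\alpha]$ that satisfy $(*)$ and (N); in particular, this pair is least favorable. -/

import Mathlib

open MeasureTheory
open scoped ENNReal NNReal

/-- The data of a density band: measurable bounds `0 ≤ lo ≤ up` with `∫ lo ≤ 1 ≤ ∫ up`.
The upper bound may take the value `∞` and may have infinite integral. -/
structure IsDensityBand {Ω : Type*} [MeasurableSpace Ω] (μ : Measure Ω)
    (lo up : Ω → ℝ≥0∞) : Prop where
  measurable_lo : Measurable lo
  measurable_up : Measurable up
  lo_le_up : ∀ᵐ ω ∂μ, lo ω ≤ up ω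
  lintegral_lo_le_one : ∫⁻ ω, lo ω ∂μ ≤ 1
  one_le_lintegral_up : 1 ≤ ∫⁻ ω, up ω ∂μ

/-- The band class: all probability densities `p` with respect to `μ` with `lo ≤ p ≤ up`.
The distribution with density `p` is `μ.withDensity p`. -/
def bandClass {Ω : Type*} [MeasurableSpace Ω] (μ : Measure Ω) (lo up : Ω → ℝ≥0∞) :
    Set (Ω → ℝ≥0∞) :=
  {p | Measurable p ∧ ∫⁻ ω, p ω ∂μ = 1 ∧ ∀ᵐ ω ∂μ, lo ω ≤ p ω ∧ p ω ≤ up ω}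

/-- `z` is a `[0, ∞]`-valued version of the likelihood ratio `q₁ / q₀`: the two agree almost
everywhere outside the common zero set of `q₀` and `q₁`, where the quotient is the undetermined
form `0 / 0`. (In `ℝ≥0∞`, `a / 0 = ∞` for `a ≠ 0`.) -/
def IsLikelihoodRatio {Ω : Type*} [MeasurableSpace Ω] (μ : Measure Ω)
    (q₀ q₁ z : Ω → ℝ≥0∞) : Prop :=
  Measurable z ∧ ∀ᵐ ω ∂μ, (q₀ ω ≠ 0 ∨ q₁ ω ≠ 0) → z ω = q₁ ω / q₀ ω

/-- The stochastic dominance inequalities for the statistic `z`, restricted to the event `S`: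
`Q₀[S, z > η] ≥ P₀[S, z > η]` and `Q₁[S, z ≤ η] ≥ P₁[S, z ≤ η]` for all `(P₀, P₁)` in the
uncertainty classes and all `η ≥ 0`. -/
def StochasticDominanceOn {Ω : Type*} [MeasurableSpace Ω] (μ : Measure Ω)
    (C₀ C₁ : Set (Ω → ℝ≥0∞)) (q₀ q₁ z : Ω → ℝ≥0∞) (S : Set Ω) : Prop :=
  ∀ p₀ ∈ C₀, ∀ p₁ ∈ C₁, ∀ η : ℝ≥0,
    μ.withDensity p₀ (S ∩ {ω | (η : ℝ≥0∞) < z ω}) ≤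
        μ.withDensity q₀ (S ∩ {ω | (η : ℝ≥0∞) < z ω}) ∧
      μ.withDensity p₁ (S ∩ {ω | z ω ≤ (η : ℝ≥0∞)}) ≤
        μ.withDensity q₁ (S ∩ {ω | z ω ≤ (η : ℝ≥0∞)})

/-- The pair `(q₀, q₁)` is least favorable for the classes `C₀`, `C₁` in the sense of stochastic
dominance: the dominance inequalities hold on the whole space for some version of the likelihood
ratio. -/
def IsLeastFavorable {Ω : Type*} [MeasurableSpace Ω] (μ : Measure Ω)
    (C₀ C₁ : Set (Ω → ℝ≥0∞)) (q₀ q₁ : Ω → ℝ≥0∞) : Prop :=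
  q₀ ∈ C₀ ∧ q₁ ∈ C₁ ∧
    ∃ z, IsLikelihoodRatio μ q₀ q₁ z ∧ StochasticDominanceOn μ C₀ C₁ q₀ q₁ z Set.univ

/-- The coupled fixed-point equations, with `α ≥ 0` and `c₀, c₁ ∈ (0, 1 / α]`; the division is
the one of `ℝ≥0∞`, so that `1 / 0 = ∞` and `c₀`, `c₁` are arbitrary positive reals for `α = 0`. -/
structure SolvesBandEquations {Ω : Type*} [MeasurableSpace Ω] (μ : Measure Ω)
    (lo₀ up₀ lo₁ up₁ : Ω → ℝ≥0∞) (α c₀ c₁ : ℝ≥0) (q₀ q₁ : Ω → ℝ≥0∞) : Prop where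
  c₀_mem : 0 < c₀ ∧ (c₀ : ℝ≥0∞) ≤ 1 / (α : ℝ≥0∞)
  c₁_mem : 0 < c₁ ∧ (c₁ : ℝ≥0∞) ≤ 1 / (α : ℝ≥0∞)
  eq₀ : ∀ᵐ ω ∂μ, q₀ ω = min (up₀ ω) (max (c₀ * (α * q₀ ω + q₁ ω)) (lo₀ ω))
  eq₁ : ∀ᵐ ω ∂μ, q₁ ω = min (up₁ ω) (max (c₁ * (q₀ ω + α * q₁ ω)) (lo₁ ω))

/-- Nondegeneracy. At a point where `q₀ = q₁ = 0` the fixed-point equations only say that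
`lo₀ = lo₁ = 0`. Such points are admitted freely if
`c₀ c₁ ≤ (1 - α c₀) (1 - α c₁)`, and otherwise only where one of the upper bounds is zero. -/
def NondegenerateZeros {Ω : Type*} [MeasurableSpace Ω] (μ : Measure Ω)
    (up₀ up₁ : Ω → ℝ≥0∞) (α c₀ c₁ : ℝ≥0) (q₀ q₁ : Ω → ℝ≥0∞) : Prop :=
  (c₀ : ℝ) * c₁ ≤ (1 - (α : ℝ) * c₀) * (1 - (α : ℝ) * c₁) ∨
    ∀ᵐ ω ∂μ, q₀ ω = 0 → q₁ ω = 0 → up₀ ω = 0 ∨ up₁ ω = 0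

/-! ### Dominance from the fixed-point equations -/

section Dominance

variable {Ω : Type*} [MeasurableSpace Ω] {μ : Measure Ω}

/-! Dominance is a threshold argument. If `c₀ (α + η) ≥ 1`, then `q₁ > η q₀` forces `q₀ < c₀ (α q₀ +
q₁)`, so `q₀` sits at its upper bound on the event and no competitor puts more mass there. Otherwise
`q₀` sits at its lower bound off the event, and the same conclusion follows because total masses are
equal. The argument for `q₁` is the same, with the alternative `η < c₁ (1 + α η)`. Condition (N)
makes it possible to choose the ratio at common zeros consistently with both thresholds.

Existence uses `α = 1` and `c = u / (1 + u)`: the equations then say that `q₀` is `u q₁` and `q₁` is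
`v q₀`, each truncated to its own band. Let `a₀`, `A₀` be the truncations of `u lo₁`, `u up₁` to
band 0, and `a₁`, `A₁` those of `v lo₀`, `v up₀` to band 1. Then `(a₀, a₁)` solves the equations if
`u v ≤ 1` (`lower_pair`), and `(A₀, A₁)` does if `u v ≥ 1` (`eq_lower_of_upper_pair`). If `u v = 1`,
any `q₀` between `a₀` and `A₀` extends to a solution (`mul_eq_clip_of_lt`).

When both lower masses are below one, `exists_balanced_factor` picks `u` and `v = 1 / u` so that in
the third family `q₁` has mass one whenever `q₀` has. If `a₀` has mass at least one, so has `a₁`,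
and both factors are lowered until the masses are one. If `A₀` has mass at most one, so has `A₁`,
and both factors are raised, possibly to `∞`. In between, the third family contains a solution. If
one band is a single density, the second family suffices. -/

theorem eq_upper_of_lt {lo up x q : ℝ≥0∞} (h : q = min up (max x lo)) (hx : q < x) : q = up := by
  rcases min_choice up (max x lo) with h' | h'
  · rw [h, h']
  · rw [h'] at h
    exact absurd (h ▸ le_max_left x lo) (not_le.2 hx)

theorem eq_lower_of_lt {lo up x q : ℝ≥0∞} (hle : lo ≤ up) (h : q = min up (max x lo))
    (hx : x < q) : q = lo := by
  have h1 : q ≤ max x lo := h ▸ min_le_right _ _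
  have h2 : lo ≤ q := h ▸ le_min hle (le_max_right _ _)
  rcases le_max_iff.1 h1 with h3 | h3
  · exact absurd h3 (not_le.2 hx)
  · exact le_antisymm h3 h2

theorem eq_clip_of_forall {lo up x q : ℝ≥0∞} (hlo : lo ≤ q) (hup : q ≤ up)
    (h1 : q < x → q = up) (h2 : x < q → q = lo) : q = min up (max x lo) := by
  rcases lt_trichotomy q x with h | h | h
  · rw [max_eq_left (hlo.trans h.le), ← h1 h, min_eq_left h.le]
  · rw [← h, max_eq_left hlo, min_eq_right hup]
  · rw [← h2 h, max_eq_right h.le, min_eq_right hup]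

theorem withDensity_le_of_le_on {p q : Ω → ℝ≥0∞} {A : Set Ω} (hA : MeasurableSet A)
    (h : ∀ᵐ ω ∂μ, ω ∈ A → p ω ≤ q ω) : μ.withDensity p A ≤ μ.withDensity q A := by
  rw [withDensity_apply _ hA, withDensity_apply _ hA]
  exact setLIntegral_mono_ae' hA h

theorem withDensity_le_of_le_off {p q : Ω → ℝ≥0∞} {A : Set Ω} (hA : MeasurableSet A)
    (hp : ∫⁻ ω, p ω ∂μ = 1) (hq : ∫⁻ ω, q ω ∂μ = 1)
    (h : ∀ᵐ ω ∂μ, ω ∉ A → q ω ≤ p ω) : μ.withDensity p A ≤ μ.withDensity q A := by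
  have hc := withDensity_le_of_le_on hA.compl h
  rw [withDensity_apply _ hA.compl, withDensity_apply _ hA.compl] at hc
  rw [withDensity_apply _ hA, withDensity_apply _ hA]
  have h1 := lintegral_add_compl (μ := μ) p hA
  have h2 := lintegral_add_compl (μ := μ) q hA
  rw [hp] at h1
  rw [hq] at h2
  have hfin : ∫⁻ ω in Aᶜ, q ω ∂μ ≠ ∞ :=
    ne_top_of_le_ne_top ENNReal.one_ne_top (h2 ▸ le_add_self)
  refine (ENNReal.add_le_add_iff_right hfin).1 ?_
  rw [h2, ← h1]
  gcongr

theorem ae_ne_top_of_mem_bandClass {lo up q : Ω → ℝ≥0∞} (h : q ∈ bandClass μ lo up) :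
    ∀ᵐ ω ∂μ, q ω ≠ ∞ := by
  filter_upwards [ae_lt_top h.1 (by rw [h.2.1]; exact ENNReal.one_ne_top)] with ω hω
  exact hω.ne

theorem lt_quotient_iff {a b : ℝ≥0∞} {η : ℝ≥0} (ha : a ≠ ∞) :
    (η : ℝ≥0∞) < b / a ↔ η * a < b :=
  ENNReal.lt_div_iff_mul_lt (Or.inr ENNReal.coe_ne_top) (Or.inl ha)

theorem lt_mix_of_threshold_le {α c η : ℝ≥0} {a b : ℝ≥0∞} (ha : a ≠ ∞) (hb : b ≠ ∞)
    (hc : 0 < c) (hη : 1 ≤ c * (α + η)) (h : η * a < b) : a < c * (α * a + b) := by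
  lift a to ℝ≥0 using ha
  lift b to ℝ≥0 using hb
  norm_cast at h ⊢
  rw [← NNReal.coe_lt_coe] at *
  rw [← NNReal.coe_le_coe] at hη
  push_cast at *
  nlinarith [mul_lt_mul_of_pos_left h hc, mul_le_mul_of_nonneg_right hη a.2]

theorem mix_lt_of_lt_threshold {α c η : ℝ≥0} {a b : ℝ≥0∞} (ha : a ≠ ∞) (hb : b ≠ ∞)
    (ha0 : a ≠ 0) (hη : c * (α + η) < 1) (h : b ≤ η * a) : c * (α * a + b) < a := by
  lift a to ℝ≥0 using ha
  lift b to ℝ≥0 using hb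
  norm_cast at h ha0 ⊢
  have ha' : (0 : ℝ) < a := NNReal.coe_pos.2 (pos_iff_ne_zero.2 ha0)
  rw [← NNReal.coe_lt_coe] at *
  rw [← NNReal.coe_le_coe] at h
  push_cast at *
  nlinarith [mul_le_mul_of_nonneg_left h c.2, mul_lt_mul_of_pos_right hη ha']

theorem lt_mix_of_lt_threshold {α c η : ℝ≥0} {a b : ℝ≥0∞} (ha : a ≠ ∞) (hb : b ≠ ∞)
    (ha0 : a ≠ 0) (hαc : α * c ≤ 1) (hη : η < c * (1 + α * η)) (h : b ≤ η * a) :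
    b < c * (a + α * b) := by
  lift a to ℝ≥0 using ha
  lift b to ℝ≥0 using hb
  norm_cast at h ha0 ⊢
  have ha' : (0 : ℝ) < a := NNReal.coe_pos.2 (pos_iff_ne_zero.2 ha0)
  rw [← NNReal.coe_lt_coe] at *
  rw [← NNReal.coe_le_coe] at h hαc
  push_cast at *
  nlinarith [mul_le_mul_of_nonneg_left h (sub_nonneg.2 hαc), mul_lt_mul_of_pos_right hη ha']

theorem mix_lt_of_threshold_le {α c η : ℝ≥0} {a b : ℝ≥0∞} (ha : a ≠ ∞) (hb : b ≠ ∞)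
    (hc : 0 < c) (hη : c * (1 + α * η) ≤ η) (h : η * a < b) :
    c * (a + α * b) < b := by
  lift a to ℝ≥0 using ha
  lift b to ℝ≥0 using hb
  norm_cast at h ⊢
  rw [← NNReal.coe_lt_coe] at *
  rw [← NNReal.coe_le_coe] at hη
  push_cast at *
  have hη0 : (0 : ℝ) ≤ η := η.2
  -- The hypothesis `hη` reads `c ≤ η (1 - α c)` with `c > 0`.
  have hpos : 0 < 1 - (α : ℝ) * c := by
    by_contra hcon
    nlinarith [mul_nonneg hη0 (sub_nonneg.2 (not_lt.1 hcon))]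
  nlinarith [mul_lt_mul_of_pos_left h hpos, mul_le_mul_of_nonneg_right hη a.2]

theorem coe_le_one_div_iff {α c : ℝ≥0} : (c : ℝ≥0∞) ≤ 1 / (α : ℝ≥0∞) ↔ α * c ≤ 1 := by
  rw [ENNReal.le_div_iff_mul_le (Or.inr one_ne_zero) (Or.inr ENNReal.one_ne_top), mul_comm]
  norm_cast

/-- Any statistic that agrees with the likelihood ratio on `{q₀ + q₁ > 0}` satisfies the dominance
inequalities on `S`, if its values at the common zeros of `q₀` and `q₁` in `S` are compatible with
the two thresholds. -/
theorem stochasticDominanceOn_of_solvesBandEquations {lo₀ up₀ lo₁ up₁ q₀ q₁ z : Ω → ℝ≥0∞}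
    {α c₀ c₁ : ℝ≥0} {S : Set Ω}
    (h₀ : IsDensityBand μ lo₀ up₀) (h₁ : IsDensityBand μ lo₁ up₁)
    (hq₀ : q₀ ∈ bandClass μ lo₀ up₀) (hq₁ : q₁ ∈ bandClass μ lo₁ up₁)
    (hsol : SolvesBandEquations μ lo₀ up₀ lo₁ up₁ α c₀ c₁ q₀ q₁)
    (hS : MeasurableSet S) (hSz : ∀ ω, q₀ ω ≠ 0 ∨ q₁ ω ≠ 0 → ω ∈ S)
    (hz : Measurable z) (hzq : ∀ ω, q₀ ω ≠ 0 ∨ q₁ ω ≠ 0 → z ω = q₁ ω / q₀ ω)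
    (hzero : ∀ᵐ ω ∂μ, ω ∈ S → q₀ ω = 0 → q₁ ω = 0 →
      (∀ η : ℝ≥0, 1 ≤ c₀ * (α + η) → (η : ℝ≥0∞) < z ω → up₀ ω = 0) ∧
      (∀ η : ℝ≥0, η < c₁ * (1 + α * η) → z ω ≤ η → up₁ ω = 0)) :
    StochasticDominanceOn μ (bandClass μ lo₀ up₀) (bandClass μ lo₁ up₁) q₀ q₁ z S := by
  intro p₀ hp₀ p₁ hp₁ η
  have hA : MeasurableSet (S ∩ {ω | (η : ℝ≥0∞) < z ω}) :=
    hS.inter (measurableSet_lt measurable_const hz)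
  have hB : MeasurableSet (S ∩ {ω | z ω ≤ (η : ℝ≥0∞)}) :=
    hS.inter (measurableSet_le hz measurable_const)
  constructor
  · by_cases hη : 1 ≤ c₀ * (α + η)
    · refine withDensity_le_of_le_on hA ?_
      filter_upwards [hp₀.2.2, hsol.eq₀, hzero, ae_ne_top_of_mem_bandClass hq₀,
        ae_ne_top_of_mem_bandClass hq₁] with ω hp he h0 ht₀ ht₁ ⟨hωS, hωz⟩
      refine hp.2.trans ?_
      by_cases hD : q₀ ω ≠ 0 ∨ q₁ ω ≠ 0
      · rw [Set.mem_ofPred_eq, hzq ω hD, lt_quotient_iff ht₀] at hωz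
        exact (eq_upper_of_lt he (lt_mix_of_threshold_le ht₀ ht₁ hsol.c₀_mem.1 hη hωz)).ge
      · push Not at hD
        rw [(h0 hωS hD.1 hD.2).1 η hη hωz]
        exact zero_le
    · refine withDensity_le_of_le_off hA hp₀.2.1 hq₀.2.1 ?_
      filter_upwards [hp₀.2.2, hsol.eq₀, h₀.lo_le_up, ae_ne_top_of_mem_bandClass hq₀,
        ae_ne_top_of_mem_bandClass hq₁] with ω hp he hle ht₀ ht₁ hω
      by_cases hD : q₀ ω ≠ 0 ∨ q₁ ω ≠ 0
      · have hωz : ¬ (η : ℝ≥0∞) < z ω := fun h => hω ⟨hSz ω hD, h⟩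
        rw [hzq ω hD, lt_quotient_iff ht₀, not_lt] at hωz
        have ha0 : q₀ ω ≠ 0 := by
          intro h
          rw [h, mul_zero, nonpos_iff_eq_zero] at hωz
          simp [h, hωz] at hD
        rw [eq_lower_of_lt hle he (mix_lt_of_lt_threshold ht₀ ht₁ ha0 (not_le.1 hη) hωz)]
        exact hp.1
      · push Not at hD
        rw [hD.1]
        exact zero_le
  · by_cases hη : η < c₁ * (1 + α * η)
    · refine withDensity_le_of_le_on hB ?_
      filter_upwards [hp₁.2.2, hsol.eq₁, hzero, ae_ne_top_of_mem_bandClass hq₀,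
        ae_ne_top_of_mem_bandClass hq₁] with ω hp he h0 ht₀ ht₁ ⟨hωS, hωz⟩
      refine hp.2.trans ?_
      by_cases hD : q₀ ω ≠ 0 ∨ q₁ ω ≠ 0
      · rw [Set.mem_ofPred_eq, hzq ω hD, ← not_lt, lt_quotient_iff ht₀, not_lt] at hωz
        have ha0 : q₀ ω ≠ 0 := by
          intro h
          rw [h, mul_zero, nonpos_iff_eq_zero] at hωz
          simp [h, hωz] at hD
        exact (eq_upper_of_lt he (lt_mix_of_lt_threshold ht₀ ht₁ ha0
          (coe_le_one_div_iff.1 hsol.c₁_mem.2) hη hωz)).ge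
      · push Not at hD
        rw [(h0 hωS hD.1 hD.2).2 η hη hωz]
        exact zero_le
    · refine withDensity_le_of_le_off hB hp₁.2.1 hq₁.2.1 ?_
      filter_upwards [hp₁.2.2, hsol.eq₁, h₁.lo_le_up, ae_ne_top_of_mem_bandClass hq₀,
        ae_ne_top_of_mem_bandClass hq₁] with ω hp he hle ht₀ ht₁ hω
      by_cases hD : q₀ ω ≠ 0 ∨ q₁ ω ≠ 0
      · have hωz : ¬ z ω ≤ (η : ℝ≥0∞) := fun h => hω ⟨hSz ω hD, h⟩
        rw [hzq ω hD, not_le, lt_quotient_iff ht₀] at hωz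
        rw [eq_lower_of_lt hle he
          (mix_lt_of_threshold_le ht₀ ht₁ hsol.c₁_mem.1 (not_lt.1 hη) hωz)]
        exact hp.1
      · push Not at hD
        rw [hD.2]
        exact zero_le

theorem measurableSet_ne_zero_or_ne_zero {q₀ q₁ : Ω → ℝ≥0∞} (h₀ : Measurable q₀)
    (h₁ : Measurable q₁) : MeasurableSet {ω | q₀ ω ≠ 0 ∨ q₁ ω ≠ 0} :=
  (h₀ (measurableSet_singleton 0).compl).union (h₁ (measurableSet_singleton 0).compl)

theorem stochasticDominanceOn_quotient {lo₀ up₀ lo₁ up₁ q₀ q₁ : Ω → ℝ≥0∞} {α c₀ c₁ : ℝ≥0}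
    (h₀ : IsDensityBand μ lo₀ up₀) (h₁ : IsDensityBand μ lo₁ up₁)
    (hq₀ : q₀ ∈ bandClass μ lo₀ up₀) (hq₁ : q₁ ∈ bandClass μ lo₁ up₁)
    (hsol : SolvesBandEquations μ lo₀ up₀ lo₁ up₁ α c₀ c₁ q₀ q₁) :
    StochasticDominanceOn μ (bandClass μ lo₀ up₀) (bandClass μ lo₁ up₁) q₀ q₁
      (fun ω => q₁ ω / q₀ ω) {ω | q₀ ω ≠ 0 ∨ q₁ ω ≠ 0} := by
  refine stochasticDominanceOn_of_solvesBandEquations h₀ h₁ hq₀ hq₁ hsol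
    (measurableSet_ne_zero_or_ne_zero hq₀.1 hq₁.1) (fun _ h => h) (hq₁.1.div hq₀.1)
    (fun _ _ => rfl) (Filter.Eventually.of_forall fun ω hω ha hb => ?_)
  simp [ha, hb] at hω

theorem isLeastFavorable_of_solvesBandEquations {lo₀ up₀ lo₁ up₁ q₀ q₁ : Ω → ℝ≥0∞}
    {α c₀ c₁ : ℝ≥0}
    (h₀ : IsDensityBand μ lo₀ up₀) (h₁ : IsDensityBand μ lo₁ up₁)
    (hq₀ : q₀ ∈ bandClass μ lo₀ up₀) (hq₁ : q₁ ∈ bandClass μ lo₁ up₁)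
    (hsol : SolvesBandEquations μ lo₀ up₀ lo₁ up₁ α c₀ c₁ q₀ q₁)
    (hN : NondegenerateZeros μ up₀ up₁ α c₀ c₁ q₀ q₁) :
    IsLeastFavorable μ (bandClass μ lo₀ up₀) (bandClass μ lo₁ up₁) q₀ q₁ := by
  classical
  have hD := measurableSet_ne_zero_or_ne_zero hq₀.1 hq₁.1
  refine ⟨hq₀, hq₁, ?_⟩
  rcases hN with hN | hN
  · have hc₀ : (0 : ℝ) < c₀ := hsol.c₀_mem.1
    have hc₁ : (0 : ℝ) < c₁ := hsol.c₁_mem.1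
    have hα₀ : (α : ℝ) * c₀ ≤ 1 := by exact_mod_cast coe_le_one_div_iff.1 hsol.c₀_mem.2
    have hα₁ : (α : ℝ) * c₁ ≤ 1 := by exact_mod_cast coe_le_one_div_iff.1 hsol.c₁_mem.2
    -- `s` is the threshold of the first test, `c₀ (α + s) = 1`. By (N) it is not below the
    -- threshold of the second, so `z = s` at common zeros leaves no `η` critical for either
    -- inequality.
    obtain ⟨s, hs⟩ : ∃ s : ℝ≥0, (s : ℝ) * c₀ = 1 - α * c₀ :=
      ⟨⟨(1 - α * c₀) / c₀, div_nonneg (sub_nonneg.2 hα₀) hc₀.le⟩, div_mul_cancel₀ _ hc₀.ne'⟩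
    have hz : Measurable (fun ω => if q₀ ω ≠ 0 ∨ q₁ ω ≠ 0 then q₁ ω / q₀ ω else (s : ℝ≥0∞)) :=
      Measurable.ite hD (hq₁.1.div hq₀.1) measurable_const
    refine ⟨_, ⟨hz, Filter.Eventually.of_forall fun ω hω => if_pos hω⟩, ?_⟩
    refine stochasticDominanceOn_of_solvesBandEquations h₀ h₁ hq₀ hq₁ hsol MeasurableSet.univ
      (fun _ _ => trivial) hz (fun ω hω => if_pos hω)
      (Filter.Eventually.of_forall fun ω _ ha hb => ?_)
    rw [if_neg (by simp [ha, hb])]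
    constructor
    · intro η hη hlt
      have hlt' : (η : ℝ) < s := by exact_mod_cast hlt
      have hη' : (1 : ℝ) ≤ c₀ * (α + η) := by exact_mod_cast hη
      nlinarith
    · intro η hη hle
      have hle' : (s : ℝ) ≤ η := by exact_mod_cast hle
      have hη' : (η : ℝ) < c₁ * (1 + α * η) := by exact_mod_cast hη
      have hs1 : (c₁ : ℝ) ≤ s * (1 - α * c₁) := by
        rw [← hs] at hN
        nlinarith
      nlinarith [mul_le_mul_of_nonneg_right hle' (sub_nonneg.2 hα₁)]
  -- At a common zero one of the classes has no mass; the value `0` or `∞` puts the point on the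
  -- side where only that class is tested.
  · have hz : Measurable (fun ω => if q₀ ω ≠ 0 ∨ q₁ ω ≠ 0 then q₁ ω / q₀ ω else
        if up₁ ω = 0 then 0 else (∞ : ℝ≥0∞)) :=
      Measurable.ite hD (hq₁.1.div hq₀.1) (Measurable.ite
        (h₁.measurable_up (measurableSet_singleton 0)) measurable_const measurable_const)
    refine ⟨_, ⟨hz, Filter.Eventually.of_forall fun ω hω => if_pos hω⟩, ?_⟩
    refine stochasticDominanceOn_of_solvesBandEquations h₀ h₁ hq₀ hq₁ hsol MeasurableSet.univ
      (fun _ _ => trivial) hz (fun ω hω => if_pos hω) ?_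
    filter_upwards [hN] with ω hω _ ha hb
    rw [if_neg (by simp [ha, hb])]
    by_cases h : up₁ ω = 0
    · simp [h]
    · simp [h, (hω ha hb).resolve_right h]

end Dominance

/-! ### Pointwise truncation and the three families of solutions -/

section Clip

/-- The value `x` truncated to the interval `[lo, up]`. -/
def clip (lo up x : ℝ≥0∞) : ℝ≥0∞ := min up (max x lo)

theorem clip_le {lo up x : ℝ≥0∞} : clip lo up x ≤ up := min_le_left _ _

theorem le_clip {lo up x : ℝ≥0∞} (h : lo ≤ up) : lo ≤ clip lo up x := le_min h (le_max_right _ _)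

theorem clip_mono {lo up x y : ℝ≥0∞} (h : x ≤ y) : clip lo up x ≤ clip lo up y :=
  min_le_min_left _ (max_le_max_right _ h)

theorem clip_self {lo x : ℝ≥0∞} : clip lo lo x = lo := min_eq_left (le_max_right _ _)

theorem clip_eq_upper {lo up x : ℝ≥0∞} (h : clip lo up x < x) : clip lo up x = up :=
  eq_upper_of_lt rfl h

theorem clip_eq_lower {lo up x : ℝ≥0∞} (hle : lo ≤ up) (h : x < clip lo up x) :
    clip lo up x = lo :=
  eq_lower_of_lt hle rfl h

/-- Truncation of `u f` grows at most linearly in `u`; this gives continuity of the mass without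
dominated convergence. -/
theorem mul_clip_le {lo up f : ℝ≥0∞} {u v : ℝ≥0} (h : u ≤ v) :
    u * clip lo up (v * f) ≤ v * clip lo up (u * f) := by
  have hm : Monotone fun x : ℝ≥0∞ => (v : ℝ≥0∞) * x := fun _ _ h => by dsimp only; gcongr
  have e : v * clip lo up (u * f) = min (v * up) (max (v * (u * f)) (v * lo)) := by
    unfold clip
    rw [hm.map_min, hm.map_max]
  have huv : (u : ℝ≥0∞) ≤ v := by exact_mod_cast h
  rw [e]
  refine le_min (mul_le_mul' huv clip_le) ?_
  refine (mul_le_mul_right (min_le_right _ _) _).trans ?_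
  rcases max_choice ((v : ℝ≥0∞) * f) lo with h' | h' <;> rw [h']
  · exact le_max_of_le_left (by rw [mul_left_comm])
  · exact le_max_of_le_right (mul_le_mul' huv le_rfl)

theorem clip_le_add {lo up x : ℝ≥0∞} : clip lo up x ≤ lo + x :=
  (min_le_right _ _).trans (max_le le_add_self le_self_add)

/-- The limit of an infinite factor: the truncation reaches `up` where `f ≠ 0`, but does not move
where `f = 0`. -/
theorem le_iSup_clip {lo up f : ℝ≥0∞} :
    (if f = 0 then clip lo up 0 else up) ≤ ⨆ n : ℕ, clip lo up ((n : ℝ≥0) * f) := by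
  split_ifs with hf
  · exact le_iSup_of_le 0 (by simp)
  · refine le_of_forall_lt fun c hc => ?_
    obtain ⟨d, hcd, hd⟩ := exists_between hc
    obtain ⟨n, hn⟩ := ENNReal.exists_nat_mul_gt hf (hd.trans_le le_top).ne
    refine hcd.trans_le (le_iSup_of_le n (le_min hd.le (le_max_of_le_left ?_)))
    simpa using hn.le

/-- If the first value is below both `up₀` and `u` times the second, then it is at least `u lo₁`, so
the second exceeds `lo₁` and hence is at most `v lo₀`. With `u v ≤ 1` this bounds `u` times the
second by `lo₀`, a contradiction. -/
theorem lower_pair {lo₀ up₀ lo₁ up₁ : ℝ≥0∞} {u v : ℝ≥0} (huv : u * v ≤ 1)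
    (h₀ : lo₀ ≤ up₀) (h₁ : lo₁ ≤ up₁) :
    (clip lo₀ up₀ (u * lo₁) < u * clip lo₁ up₁ (v * lo₀) → clip lo₀ up₀ (u * lo₁) = up₀) ∧
      (u * clip lo₁ up₁ (v * lo₀) < clip lo₀ up₀ (u * lo₁) → clip lo₀ up₀ (u * lo₁) = lo₀) := by
  constructor
  · intro h
    by_contra hne
    have h1 : u * lo₁ ≤ clip lo₀ up₀ (u * lo₁) := not_lt.1 fun h' => hne (clip_eq_upper h')
    have h2 : clip lo₁ up₁ (v * lo₀) ≠ lo₁ := fun h' => by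
      rw [h'] at h
      exact absurd h (not_lt.2 h1)
    have h3 : clip lo₁ up₁ (v * lo₀) ≤ v * lo₀ := not_lt.1 fun h' => h2 (clip_eq_lower h₁ h')
    have huv' : (u : ℝ≥0∞) * v ≤ 1 := by exact_mod_cast huv
    refine absurd h (not_lt.2 ?_)
    calc u * clip lo₁ up₁ (v * lo₀) ≤ u * (v * lo₀) := by gcongr
      _ = (u * v) * lo₀ := (mul_assoc _ _ _).symm
      _ ≤ 1 * lo₀ := by gcongr
      _ = lo₀ := one_mul _
      _ ≤ _ := le_clip h₀
  · intro h
    exact clip_eq_lower h₀ (lt_of_le_of_lt (mul_le_mul_right (le_clip h₁) _) h)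

/-- A strict gap excludes truncation of `u lo₁` from above and of `u up₁` from below. The two ends
are therefore `max (u lo₁) lo₀` and `min (u up₁) up₀`, and scaling by `v = 1 / u` exchanges the
roles of the bands. -/
theorem mul_eq_clip_of_lt {lo₀ up₀ lo₁ up₁ : ℝ≥0∞} {u v : ℝ≥0} (huv : v * u = 1)
    (h₀ : lo₀ ≤ up₀) (h : clip lo₀ up₀ (u * lo₁) < clip lo₀ up₀ (u * up₁)) :
    v * clip lo₀ up₀ (u * lo₁) = clip lo₁ up₁ (v * lo₀) ∧
      v * clip lo₀ up₀ (u * up₁) = clip lo₁ up₁ (v * up₀) := by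
  have huv' : (v : ℝ≥0∞) * u = 1 := by exact_mod_cast huv
  have hvu (x : ℝ≥0∞) : v * (u * x) = x := by rw [← mul_assoc, huv', one_mul]
  have ha : u * lo₁ ≤ clip lo₀ up₀ (u * lo₁) :=
    not_lt.1 fun h' => (h.trans_le clip_le).ne (clip_eq_upper h')
  have hA : clip lo₀ up₀ (u * up₁) ≤ u * up₁ :=
    not_lt.1 fun h' => ((le_clip h₀).trans_lt h).ne' (clip_eq_lower h₀ h')
  have hl : lo₁ ≤ v * clip lo₀ up₀ (u * lo₁) := by
    calc lo₁ = v * (u * lo₁) := (hvu _).symm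
      _ ≤ _ := by gcongr
  have hu : v * clip lo₀ up₀ (u * up₁) ≤ up₁ := by
    calc v * clip lo₀ up₀ (u * up₁) ≤ v * (u * up₁) := by gcongr
      _ = up₁ := hvu _
  have hm : v * clip lo₀ up₀ (u * lo₁) ≤ v * clip lo₀ up₀ (u * up₁) := by gcongr
  constructor
  · refine eq_clip_of_forall hl (hm.trans hu) (fun h' => ?_) (fun h' => ?_)
    · exact absurd h' (not_lt.2 (mul_le_mul_right (le_clip h₀) _))
    · refine le_antisymm ?_ hl
      have : clip lo₀ up₀ (u * lo₁) ≤ u * lo₁ := not_lt.1 fun h'' => by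
        rw [clip_eq_lower h₀ h''] at h'
        exact h'.false
      calc v * clip lo₀ up₀ (u * lo₁) ≤ v * (u * lo₁) := by gcongr
        _ = lo₁ := hvu _
  · refine eq_clip_of_forall (hl.trans hm) hu (fun h' => ?_) (fun h' => ?_)
    · refine le_antisymm hu ?_
      have : u * up₁ ≤ clip lo₀ up₀ (u * up₁) := not_lt.1 fun h'' => by
        rw [clip_eq_upper h''] at h'
        exact h'.false
      calc up₁ = v * (u * up₁) := (hvu _).symm
        _ ≤ _ := by gcongr
    · exact absurd h' (not_lt.2 (mul_le_mul_right clip_le _))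

end Clip

/-! ### Mass of a truncation as a function of the factor -/

section ClipMass

variable {Ω : Type*} [MeasurableSpace Ω]

/-- The total mass of `u • f`, truncated pointwise to the band `[lo, up]`. -/
noncomputable def clipMass (μ : Measure Ω) (lo up f : Ω → ℝ≥0∞) (u : ℝ≥0) : ℝ≥0∞ :=
  ∫⁻ ω, clip (lo ω) (up ω) (u * f ω) ∂μ

variable {μ : Measure Ω} {lo up f : Ω → ℝ≥0∞}

theorem measurable_clip {x : Ω → ℝ≥0∞} (hlo : Measurable lo) (hup : Measurable up)
    (hx : Measurable x) : Measurable fun ω => clip (lo ω) (up ω) (x ω) :=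
  hup.min (hx.max hlo)

theorem clipMass_mono : Monotone (clipMass μ lo up f) := fun u v h =>
  lintegral_mono fun ω => clip_mono (by gcongr)

theorem mul_clipMass_le (hlo : Measurable lo) (hup : Measurable up) (hf : Measurable f)
    {u v : ℝ≥0} (h : u ≤ v) : u * clipMass μ lo up f v ≤ v * clipMass μ lo up f u := by
  unfold clipMass
  rw [← lintegral_const_mul _ (measurable_clip hlo hup (hf.const_mul _)),
    ← lintegral_const_mul _ (measurable_clip hlo hup (hf.const_mul _))]
  exact lintegral_mono fun ω => mul_clip_le h

theorem clipMass_ne_top (hlo : Measurable lo) (hup : Measurable up) (hf : Measurable f)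
    {a u : ℝ≥0} (ha : 0 < a) (hfin : clipMass μ lo up f a ≠ ∞) : clipMass μ lo up f u ≠ ∞ := by
  rcases le_total u a with h | h
  · exact ne_top_of_le_ne_top hfin (clipMass_mono h)
  · intro ht
    have h1 := mul_clipMass_le (μ := μ) hlo hup hf h
    rw [ht, ENNReal.mul_top (by exact_mod_cast ha.ne')] at h1
    exact ENNReal.mul_ne_top ENNReal.coe_ne_top hfin (top_le_iff.1 h1)

theorem continuousOn_clipMass (hlo : Measurable lo) (hup : Measurable up) (hf : Measurable f)
    {a : ℝ≥0} (ha : 0 < a) (hfin : clipMass μ lo up f a ≠ ∞) :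
    ContinuousOn (fun u => (clipMass μ lo up f u).toReal) (Set.Ici a) := by
  have hfin' (u : ℝ≥0) := clipMass_ne_top (u := u) hlo hup hf ha hfin
  have hmono {u v : ℝ≥0} (h : u ≤ v) :
      (clipMass μ lo up f u).toReal ≤ (clipMass μ lo up f v).toReal :=
    ENNReal.toReal_mono (hfin' v) (clipMass_mono h)
  have hscale {u v : ℝ≥0} (h : u ≤ v) :
      u * (clipMass μ lo up f v).toReal ≤ v * (clipMass μ lo up f u).toReal := by
    have := ENNReal.toReal_mono (ENNReal.mul_ne_top ENNReal.coe_ne_top (hfin' u))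
      (mul_clipMass_le (μ := μ) hlo hup hf h)
    simpa using this
  have ha' : (0 : ℝ) < a := ha
  set R : ℝ≥0 → ℝ := fun u => (clipMass μ lo up f u).toReal with hR
  -- Since `R x / x` is nonincreasing, slopes to the right of `a` are at most `R a / a`.
  have key {x y : ℝ≥0} (hx : a ≤ x) (hxy : x ≤ y) : R y - R x ≤ R a / a * (y - x) := by
    have hx' : (0 : ℝ) < x := ha.trans_le hx
    have h1 : (x : ℝ) * R y ≤ y * R x := hscale hxy
    have h2 : (a : ℝ) * R x ≤ x * R a := hscale hx
    have hxy' : (0 : ℝ) ≤ y - x := sub_nonneg.2 (by exact_mod_cast hxy)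
    rw [div_mul_eq_mul_div, le_div_iff₀ ha']
    have h3 : (x : ℝ) * ((R y - R x) * a) ≤ x * (R a * (y - x)) := by
      nlinarith [mul_le_mul_of_nonneg_right h2 hxy']
    exact le_of_mul_le_mul_left h3 hx'
  have hK : 0 ≤ R a / a := div_nonneg ENNReal.toReal_nonneg ha'.le
  refine (LipschitzOnWith.of_le_add_mul (K := ⟨R a / a, hK⟩) fun x hx y hy => ?_).continuousOn
  change R x ≤ R y + R a / a * dist x y
  rw [NNReal.dist_eq]
  rcases le_total x y with h | h
  · have := mul_nonneg hK (abs_nonneg ((x : ℝ) - y))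
    linarith [hmono h]
  · rw [abs_of_nonneg (sub_nonneg.2 (by exact_mod_cast h))]
    linarith [key hy h]

theorem exists_clipMass_eq_one (hlo : Measurable lo) (hup : Measurable up) (hf : Measurable f)
    {a b : ℝ≥0} (ha : 0 < a) (hab : a ≤ b) (h1 : clipMass μ lo up f a ≤ 1)
    (h2 : 1 ≤ clipMass μ lo up f b) : ∃ u ∈ Set.Icc a b, clipMass μ lo up f u = 1 := by
  have hfin := ne_top_of_le_ne_top ENNReal.one_ne_top h1
  have hc := (continuousOn_clipMass hlo hup hf ha hfin).mono
    (Set.Icc_subset_Ici_self : Set.Icc a b ⊆ _)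
  have hb := clipMass_ne_top (u := b) hlo hup hf ha hfin
  obtain ⟨u, hu, h⟩ := intermediate_value_Icc hab hc
    (show (1 : ℝ) ∈ _ from ⟨by simpa using ENNReal.toReal_mono ENNReal.one_ne_top h1,
      by simpa using ENNReal.toReal_mono hb h2⟩)
  exact ⟨u, hu, (ENNReal.toReal_eq_one_iff _).1 h⟩

theorem clipMass_le_add (hlo : Measurable lo) {u : ℝ≥0} (hf : ∫⁻ ω, f ω ∂μ ≤ 1) :
    clipMass μ lo up f u ≤ ∫⁻ ω, lo ω ∂μ + u := by
  calc clipMass μ lo up f u ≤ ∫⁻ ω, (lo ω + u * f ω) ∂μ := lintegral_mono fun _ => clip_le_add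
    _ = ∫⁻ ω, lo ω ∂μ + u * ∫⁻ ω, f ω ∂μ := by
      rw [lintegral_add_left hlo, lintegral_const_mul' _ _ ENNReal.coe_ne_top]
    _ ≤ ∫⁻ ω, lo ω ∂μ + u * 1 := by gcongr
    _ = _ := by rw [mul_one]

/-- The extra summand `u` supplies the endpoint signs in `exists_balanced_factor`. -/
theorem exists_clipMass_add_le_one (hlo : Measurable lo) (hf : ∫⁻ ω, f ω ∂μ ≤ 1)
    (hl : ∫⁻ ω, lo ω ∂μ < 1) :
    ∃ δ : ℝ≥0, 0 < δ ∧ ∀ u ≤ δ, clipMass μ lo up f u + u ≤ 1 := by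
  obtain ⟨ε, hε0, hε⟩ := ENNReal.lt_iff_exists_add_pos_lt.1 hl
  refine ⟨ε / 2, half_pos hε0, fun u hu => ?_⟩
  have h2 : (u : ℝ≥0∞) + u ≤ ε := by
    have : u + u ≤ ε := (add_le_add hu hu).trans (add_halves ε).le
    exact_mod_cast this
  calc clipMass μ lo up f u + u ≤ ∫⁻ ω, lo ω ∂μ + u + u := by gcongr; exact clipMass_le_add hlo hf
    _ = ∫⁻ ω, lo ω ∂μ + (u + u) := add_assoc _ _ _
    _ ≤ ∫⁻ ω, lo ω ∂μ + ε := by gcongr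
    _ ≤ 1 := hε.le

theorem lintegral_le_one_of_forall_clipMass_le (hlo : Measurable lo) (hup : Measurable up)
    (hf : Measurable f) (h : ∀ u, clipMass μ lo up f u ≤ 1) :
    ∫⁻ ω, (if f ω = 0 then clip (lo ω) (up ω) 0 else up ω) ∂μ ≤ 1 := by
  calc _ ≤ ∫⁻ ω, ⨆ n : ℕ, clip (lo ω) (up ω) ((n : ℝ≥0) * f ω) ∂μ :=
        lintegral_mono fun _ => le_iSup_clip
    _ = ⨆ n : ℕ, clipMass μ lo up f n := by
        refine lintegral_iSup (fun n => measurable_clip hlo hup (hf.const_mul _)) ?_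
        intro m n hmn ω
        refine clip_mono ?_
        have : ((m : ℝ≥0) : ℝ≥0∞) ≤ (n : ℝ≥0) := by exact_mod_cast hmn
        gcongr
    _ ≤ 1 := iSup_le fun n => h n

theorem clipMass_eq_one_or_lintegral_le_one (hlo : Measurable lo) (hup : Measurable up)
    (hf : Measurable f) {a : ℝ≥0} (ha : 0 < a) (h : clipMass μ lo up f a ≤ 1) :
    (∃ u, a ≤ u ∧ clipMass μ lo up f u = 1) ∨
      ∫⁻ ω, (if f ω = 0 then clip (lo ω) (up ω) 0 else up ω) ∂μ ≤ 1 := by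
  by_cases hb : ∀ u, clipMass μ lo up f u ≤ 1
  · exact Or.inr (lintegral_le_one_of_forall_clipMass_le hlo hup hf hb)
  · push Not at hb
    obtain ⟨b, hb⟩ := hb
    have hab : a ≤ b := le_of_not_ge fun hba => (hb.trans_le (clipMass_mono hba)).not_ge h
    obtain ⟨u, hu, hu1⟩ := exists_clipMass_eq_one hlo hup hf ha hab h hb.le
    exact Or.inl ⟨u, hu.1, hu1⟩

theorem clip_mem_bandClass (h : IsDensityBand μ lo up) (hf : Measurable f) {u : ℝ≥0}
    (hu : clipMass μ lo up f u = 1) :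
    (fun ω => clip (lo ω) (up ω) (u * f ω)) ∈ bandClass μ lo up := by
  refine ⟨measurable_clip h.measurable_lo h.measurable_up (hf.const_mul _), hu, ?_⟩
  filter_upwards [h.lo_le_up] with ω hω
  exact ⟨le_clip hω, clip_le⟩

theorem IsDensityBand.nonempty_bandClass [SigmaFinite μ] (h : IsDensityBand μ lo up) :
    ∃ q, q ∈ bandClass μ lo up := by
  rcases h.lintegral_lo_le_one.eq_or_lt with hl | hl
  · refine ⟨lo, h.measurable_lo, hl, ?_⟩
    filter_upwards [h.lo_le_up] with ω hω
    exact ⟨le_rfl, hω⟩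
  -- A strictly positive integrable `w` exists by σ-finiteness. If its truncated multiples never
  -- reach mass one, then `up` itself has mass one.
  · obtain ⟨w, hw0, hw, hw1⟩ := exists_pos_lintegral_lt_of_sigmaFinite μ one_ne_zero
    have hwm : Measurable fun ω => (w ω : ℝ≥0∞) := hw.coe_nnreal_ennreal
    obtain ⟨a, ha, hle⟩ := exists_clipMass_add_le_one (up := up) h.measurable_lo hw1.le hl
    rcases clipMass_eq_one_or_lintegral_le_one h.measurable_lo h.measurable_up hwm ha
      (le_self_add.trans (hle a le_rfl)) with ⟨u, -, hu⟩ | hle1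
    · exact ⟨_, clip_mem_bandClass h hwm hu⟩
    · have : ∀ ω, (w ω : ℝ≥0∞) ≠ 0 := fun ω => by exact_mod_cast (hw0 ω).ne'
      simp only [this, if_false] at hle1
      refine ⟨up, h.measurable_up, le_antisymm hle1 h.one_le_lintegral_up, ?_⟩
      filter_upwards [h.lo_le_up] with ω hω
      exact ⟨hω, le_rfl⟩

/-- Starting from a truncation of mass at most one, the factor can be raised until the mass is one.
In the limiting case the factor is infinite, and the density is arbitrary where `f` vanishes. -/
theorem exists_factor_ge [SigmaFinite μ] (h : IsDensityBand μ lo up) (hf : Measurable f)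
    {a : ℝ≥0} (ha : 0 < a) (h1 : clipMass μ lo up f a ≤ 1) :
    ∃ w : ℝ≥0∞, a ≤ w ∧ ∃ q ∈ bandClass μ lo up, ∀ᵐ ω ∂μ,
      (q ω < w * f ω → q ω = up ω) ∧ (w ≠ ∞ → w * f ω < q ω → q ω = lo ω) := by
  rcases clipMass_eq_one_or_lintegral_le_one h.measurable_lo h.measurable_up hf ha h1 with
    ⟨u, hau, hu⟩ | hle
  · refine ⟨u, by exact_mod_cast hau, _, clip_mem_bandClass h hf hu, ?_⟩
    filter_upwards [h.lo_le_up] with ω hω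
    exact ⟨clip_eq_upper, fun _ => clip_eq_lower hω⟩
  · have hmeas : Measurable fun ω => if f ω = 0 then clip (lo ω) (up ω) 0 else up ω :=
      Measurable.ite (hf (measurableSet_singleton 0))
        (measurable_clip h.measurable_lo h.measurable_up measurable_const) h.measurable_up
    -- Infinite factor: `q` is pinned to `up` where `f ≠ 0`, and the missing mass is placed on `{f =
    -- 0}`.
    have hb : IsDensityBand μ (fun ω => if f ω = 0 then clip (lo ω) (up ω) 0 else up ω) up := by
      refine ⟨hmeas, h.measurable_up, Filter.Eventually.of_forall fun ω => ?_, hle,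
        h.one_le_lintegral_up⟩
      split_ifs
      exacts [clip_le, le_rfl]
    obtain ⟨q, hq⟩ := hb.nonempty_bandClass
    refine ⟨∞, le_top, q, ⟨hq.1, hq.2.1, ?_⟩, ?_⟩
    · filter_upwards [hq.2.2, h.lo_le_up] with ω hω hle
      refine ⟨le_trans ?_ hω.1, hω.2⟩
      split_ifs
      exacts [le_clip hle, hle]
    · filter_upwards [hq.2.2] with ω hω
      refine ⟨fun hlt => ?_, fun hne => absurd rfl hne⟩
      by_cases h0 : f ω = 0
      · simp [h0] at hlt
      · rw [if_neg h0] at hω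
        exact le_antisymm hω.2 hω.1

end ClipMass

/-! ### From factors to mixing coefficients -/

section Coefficient

/-- The coefficient `u / (1 + u)`, with value `1` at `u = ∞`. -/
noncomputable def mixCoeff (u : ℝ≥0∞) : ℝ≥0 :=
  if u = ∞ then 1 else u.toNNReal / (1 + u.toNNReal)

theorem mixCoeff_coe (u : ℝ≥0) : mixCoeff u = u / (1 + u) := by simp [mixCoeff]

theorem mixCoeff_pos {u : ℝ≥0∞} (hu : u ≠ 0) : 0 < mixCoeff u := by
  unfold mixCoeff
  split_ifs with h
  · exact one_pos
  · exact div_pos (ENNReal.toNNReal_pos hu h) (by positivity)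

theorem mixCoeff_le_one {u : ℝ≥0∞} : mixCoeff u ≤ 1 := by
  unfold mixCoeff
  split_ifs with h
  · exact le_rfl
  · exact div_le_one_of_le₀ le_add_self zero_le

/-- For finite `u`, `a < u / (1 + u) * (a + b)` rearranges to `a < u b`. At `u = ∞` the coefficient
`1` leaves `b > 0`, in agreement with `∞ * 0 = 0`. -/
theorem lt_mul_of_lt_mixCoeff_mul {u a b : ℝ≥0∞} (ha : a ≠ ∞) (hb : b ≠ ∞)
    (h : a < mixCoeff u * (a + b)) : a < u * b := by
  induction u with
  | top =>
    have hb0 : b ≠ 0 := fun hb0 => by simp [mixCoeff, hb0] at h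
    rw [ENNReal.top_mul hb0]
    exact ha.lt_top
  | coe u =>
    rw [mixCoeff_coe] at h
    lift a to ℝ≥0 using ha
    lift b to ℝ≥0 using hb
    norm_cast at h ⊢
    rw [div_mul_eq_mul_div, lt_div_iff₀ (by positivity)] at h
    rw [← NNReal.coe_lt_coe] at *
    push_cast at *
    linarith

theorem mul_lt_of_mixCoeff_mul_lt {u a b : ℝ≥0∞} (ha : a ≠ ∞) (hb : b ≠ ∞)
    (h : mixCoeff u * (a + b) < a) : u ≠ ∞ ∧ u * b < a := by
  induction u with
  | top => exact absurd h (by simp [mixCoeff])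
  | coe u =>
    refine ⟨ENNReal.coe_ne_top, ?_⟩
    rw [mixCoeff_coe] at h
    lift a to ℝ≥0 using ha
    lift b to ℝ≥0 using hb
    norm_cast at h ⊢
    rw [div_mul_eq_mul_div, div_lt_iff₀ (by positivity)] at h
    rw [← NNReal.coe_lt_coe] at *
    push_cast at *
    linarith

theorem mixCoeff_mul_mixCoeff_le {u v : ℝ≥0} (h : u * v ≤ 1) :
    (mixCoeff u : ℝ) * mixCoeff v ≤
      (1 - ((1 : ℝ≥0) : ℝ) * mixCoeff u) * (1 - ((1 : ℝ≥0) : ℝ) * mixCoeff v) := by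
  have h' : (u : ℝ) * v ≤ 1 := by exact_mod_cast h
  have hu : (0 : ℝ) < 1 + u := by positivity
  have hv : (0 : ℝ) < 1 + v := by positivity
  rw [mixCoeff_coe, mixCoeff_coe]
  push_cast
  have e1 : (u / (1 + u) : ℝ) * (v / (1 + v)) = (u * v) / ((1 + u) * (1 + v)) := by field_simp
  have e2 : (1 - 1 * (u / (1 + u)) : ℝ) * (1 - 1 * (v / (1 + v))) = 1 / ((1 + u) * (1 + v)) := by
    field_simp
    ring
  rw [e1, e2]
  gcongr

end Coefficient

/-! ### Existence of a solution -/

section Existence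

variable {Ω : Type*} [MeasurableSpace Ω] {μ : Measure Ω} {lo₀ up₀ lo₁ up₁ : Ω → ℝ≥0∞}

/-- The band equations have a solution with nondegenerate common zeros. -/
def BandEquationsSolvable (μ : Measure Ω) (lo₀ up₀ lo₁ up₁ : Ω → ℝ≥0∞) : Prop :=
  ∃ q₀ ∈ bandClass μ lo₀ up₀, ∃ q₁ ∈ bandClass μ lo₁ up₁, ∃ α c₀ c₁ : ℝ≥0,
    SolvesBandEquations μ lo₀ up₀ lo₁ up₁ α c₀ c₁ q₀ q₁ ∧
      NondegenerateZeros μ up₀ up₁ α c₀ c₁ q₀ q₁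

theorem solvesBandEquations_mixCoeff {q₀ q₁ : Ω → ℝ≥0∞} {u v : ℝ≥0∞} (hu : u ≠ 0) (hv : v ≠ 0)
    (hq₀ : q₀ ∈ bandClass μ lo₀ up₀) (hq₁ : q₁ ∈ bandClass μ lo₁ up₁)
    (h : ∀ᵐ ω ∂μ, ((q₀ ω < u * q₁ ω → q₀ ω = up₀ ω) ∧
        (u ≠ ∞ → u * q₁ ω < q₀ ω → q₀ ω = lo₀ ω)) ∧
      (q₁ ω < v * q₀ ω → q₁ ω = up₁ ω) ∧ (v ≠ ∞ → v * q₀ ω < q₁ ω → q₁ ω = lo₁ ω)) :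
    SolvesBandEquations μ lo₀ up₀ lo₁ up₁ 1 (mixCoeff u) (mixCoeff v) q₀ q₁ := by
  have hle {w : ℝ≥0∞} : (mixCoeff w : ℝ≥0∞) ≤ 1 / ((1 : ℝ≥0) : ℝ≥0∞) := by
    simpa using mixCoeff_le_one
  refine ⟨⟨mixCoeff_pos hu, hle⟩, ⟨mixCoeff_pos hv, hle⟩, ?_, ?_⟩
  · filter_upwards [h, hq₀.2.2, ae_ne_top_of_mem_bandClass hq₀, ae_ne_top_of_mem_bandClass hq₁]
      with ω hω hb ht₀ ht₁
    rw [ENNReal.coe_one, one_mul]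
    refine eq_clip_of_forall hb.1 hb.2
      (fun h' => hω.1.1 (lt_mul_of_lt_mixCoeff_mul ht₀ ht₁ h')) fun h' => ?_
    obtain ⟨h1, h2⟩ := mul_lt_of_mixCoeff_mul_lt ht₀ ht₁ h'
    exact hω.1.2 h1 h2
  · filter_upwards [h, hq₁.2.2, ae_ne_top_of_mem_bandClass hq₀, ae_ne_top_of_mem_bandClass hq₁]
      with ω hω hb ht₀ ht₁
    rw [ENNReal.coe_one, one_mul, add_comm]
    refine eq_clip_of_forall hb.1 hb.2
      (fun h' => hω.2.1 (lt_mul_of_lt_mixCoeff_mul ht₁ ht₀ h')) fun h' => ?_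
    obtain ⟨h1, h2⟩ := mul_lt_of_mixCoeff_mul_lt ht₁ ht₀ h'
    exact hω.2.2 h1 h2

theorem solvable_of_clipMass_lower_eq_one (h₀ : IsDensityBand μ lo₀ up₀)
    (h₁ : IsDensityBand μ lo₁ up₁) {u v : ℝ≥0} (hu : 0 < u) (hv : 0 < v) (huv : u * v ≤ 1)
    (hu1 : clipMass μ lo₀ up₀ lo₁ u = 1) (hv1 : clipMass μ lo₁ up₁ lo₀ v = 1) :
    BandEquationsSolvable μ lo₀ up₀ lo₁ up₁ := by
  have hq₀ := clip_mem_bandClass h₀ h₁.measurable_lo hu1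
  have hq₁ := clip_mem_bandClass h₁ h₀.measurable_lo hv1
  refine ⟨_, hq₀, _, hq₁, 1, mixCoeff u, mixCoeff v,
    solvesBandEquations_mixCoeff (by exact_mod_cast hu.ne') (by exact_mod_cast hv.ne') hq₀ hq₁ ?_,
    Or.inl (mixCoeff_mul_mixCoeff_le huv)⟩
  filter_upwards [h₀.lo_le_up, h₁.lo_le_up] with ω hω₀ hω₁
  have a := lower_pair huv hω₀ hω₁
  have b := lower_pair (mul_comm u v ▸ huv) hω₁ hω₀
  exact ⟨⟨a.1, fun _ => a.2⟩, b.1, fun _ => b.2⟩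

/-- Mirror image of `lower_pair`: if `q₀ ≠ lo₀`, then `q₀ ≤ u up₁`, so `q₁ < up₁` and `q₁ ≥ v up₀`,
whence `u q₁ ≥ up₀ ≥ q₀`. -/
theorem eq_lower_of_upper_pair {lo₀ up₀ up₁ q₀ q₁ u v : ℝ≥0∞} (huv : 1 ≤ u * v)
    (hq₀ : q₀ ≤ up₀) (h₀ : u * up₁ < q₀ → q₀ = lo₀) (h₁ : q₁ < v * up₀ → q₁ = up₁)
    (h : u * q₁ < q₀) : q₀ = lo₀ := by
  by_contra hne
  have h1 : q₀ ≤ u * up₁ := not_lt.1 fun h' => hne (h₀ h')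
  have h2 : q₁ ≠ up₁ := fun h' => absurd (h' ▸ h) (not_lt.2 h1)
  have h3 : v * up₀ ≤ q₁ := not_lt.1 fun h' => h2 (h₁ h')
  refine absurd h (not_lt.2 ?_)
  calc q₀ ≤ up₀ := hq₀
    _ = 1 * up₀ := (one_mul _).symm
    _ ≤ (u * v) * up₀ := by gcongr
    _ = u * (v * up₀) := mul_assoc _ _ _
    _ ≤ u * q₁ := by gcongr

theorem solvable_of_clipMass_upper_le_one [SigmaFinite μ] (h₀ : IsDensityBand μ lo₀ up₀)
    (h₁ : IsDensityBand μ lo₁ up₁) {u v : ℝ≥0} (hu : 0 < u) (hv : 0 < v) (huv : 1 ≤ u * v)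
    (hu1 : clipMass μ lo₀ up₀ up₁ u ≤ 1) (hv1 : clipMass μ lo₁ up₁ up₀ v ≤ 1) :
    BandEquationsSolvable μ lo₀ up₀ lo₁ up₁ := by
  obtain ⟨u', huu', q₀, hq₀, hc₀⟩ := exists_factor_ge h₀ h₁.measurable_up hu hu1
  obtain ⟨v', hvv', q₁, hq₁, hc₁⟩ := exists_factor_ge h₁ h₀.measurable_up hv hv1
  have hu0 : u' ≠ 0 := (lt_of_lt_of_le (by exact_mod_cast hu) huu').ne'
  have hv0 : v' ≠ 0 := (lt_of_lt_of_le (by exact_mod_cast hv) hvv').ne'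
  have huv' : 1 ≤ u' * v' :=
    le_trans (by exact_mod_cast huv : (1 : ℝ≥0∞) ≤ u * v) (mul_le_mul' huu' hvv')
  refine ⟨q₀, hq₀, q₁, hq₁, 1, mixCoeff u', mixCoeff v',
    solvesBandEquations_mixCoeff hu0 hv0 hq₀ hq₁ ?_, Or.inr ?_⟩
  · filter_upwards [hc₀, hc₁, hq₀.2.2, hq₁.2.2] with ω a b hb₀ hb₁
    exact ⟨⟨fun h => a.1 (h.trans_le (mul_le_mul_right hb₁.2 _)),
        fun ht h => eq_lower_of_upper_pair huv' hb₀.2 (a.2 ht) b.1 h⟩,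
      fun h => b.1 (h.trans_le (mul_le_mul_right hb₀.2 _)),
      fun ht h => eq_lower_of_upper_pair (mul_comm u' v' ▸ huv') hb₁.2 (b.2 ht) a.1 h⟩
  -- If `q₀ = 0` and `up₁ > 0`, then `q₀ < u' up₁`, so `q₀ = up₀` and `up₀ = 0`.
  · filter_upwards [hc₀] with ω a ha _
    by_contra hne
    push Not at hne
    refine hne.1 ((a.1 ?_).symm.trans ha)
    rw [ha]
    exact pos_iff_ne_zero.2 (mul_ne_zero hu0 hne.2)

theorem solvable_of_clipMass_le_one_le [SigmaFinite μ] (h₀ : IsDensityBand μ lo₀ up₀)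
    (h₁ : IsDensityBand μ lo₁ up₁) {u v : ℝ≥0} (huv : u * v = 1)
    (hbal : clipMass μ lo₁ up₁ lo₀ v + v = v * clipMass μ lo₀ up₀ lo₁ u + 1)
    (hlo : clipMass μ lo₀ up₀ lo₁ u ≤ 1) (hup : 1 ≤ clipMass μ lo₀ up₀ up₁ u) :
    BandEquationsSolvable μ lo₀ up₀ lo₁ up₁ := by
  classical
  have hvu : v * u = 1 := mul_comm u v ▸ huv
  have hu : u ≠ 0 := left_ne_zero_of_mul_eq_one huv
  have hv : v ≠ 0 := right_ne_zero_of_mul_eq_one huv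
  set a₀ : Ω → ℝ≥0∞ := fun ω => clip (lo₀ ω) (up₀ ω) (u * lo₁ ω) with ha₀
  set A₀ : Ω → ℝ≥0∞ := fun ω => clip (lo₀ ω) (up₀ ω) (u * up₁ ω) with hA₀
  set a₁ : Ω → ℝ≥0∞ := fun ω => clip (lo₁ ω) (up₁ ω) (v * lo₀ ω) with ha₁
  have ma₀ : Measurable a₀ :=
    measurable_clip h₀.measurable_lo h₀.measurable_up (h₁.measurable_lo.const_mul _)
  have mA₀ : Measurable A₀ :=
    measurable_clip h₀.measurable_lo h₀.measurable_up (h₁.measurable_up.const_mul _)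
  have ma₁ : Measurable a₁ :=
    measurable_clip h₁.measurable_lo h₁.measurable_up (h₀.measurable_lo.const_mul _)
  have hband : IsDensityBand μ a₀ A₀ := by
    refine ⟨ma₀, mA₀, ?_, hlo, hup⟩
    filter_upwards [h₁.lo_le_up] with ω hω
    exact clip_mono (mul_le_mul_right hω _)
  obtain ⟨q₀, hq₀⟩ := hband.nonempty_bandClass
  -- Where `q₀` leaves `a₀`, the pair moves along the ray `q₁ = v q₀`, on which both equations hold
  -- because `u v = 1`.
  set q₁ : Ω → ℝ≥0∞ := fun ω => if a₀ ω < q₀ ω then v * q₀ ω else a₁ ω with hq₁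
  have mq₁ : Measurable q₁ :=
    Measurable.ite (measurableSet_lt ma₀ hq₀.1) (hq₀.1.const_mul _) ma₁
  have hpair : ∀ᵐ ω ∂μ, a₀ ω < q₀ ω → v * a₀ ω = a₁ ω ∧
      v * A₀ ω = clip (lo₁ ω) (up₁ ω) (v * up₀ ω) := by
    filter_upwards [h₀.lo_le_up, hq₀.2.2] with ω hω hb hlt
    exact mul_eq_clip_of_lt hvu hω (hlt.trans_le hb.2)
  -- The difference `q₁ - v q₀` does not depend on `q₀`, so `hbal` determines the mass of `q₁`.
  have hsum : ∀ᵐ ω ∂μ, q₁ ω + v * a₀ ω = a₁ ω + v * q₀ ω := by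
    filter_upwards [hpair, hq₀.2.2] with ω hω hb
    by_cases hlt : a₀ ω < q₀ ω
    · simp only [hq₁, if_pos hlt, (hω hlt).1, add_comm]
    · simp only [hq₁, if_neg hlt, le_antisymm (not_lt.1 hlt) hb.1]
  have hint : ∫⁻ ω, q₁ ω ∂μ = 1 := by
    have h := lintegral_congr_ae hsum
    rw [lintegral_add_left mq₁, lintegral_add_left ma₁,
      lintegral_const_mul' _ _ ENNReal.coe_ne_top, lintegral_const_mul' _ _ ENNReal.coe_ne_top,
      hq₀.2.1, mul_one] at h
    change _ + v * clipMass μ lo₀ up₀ lo₁ u = clipMass μ lo₁ up₁ lo₀ v + v at h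
    rw [hbal, add_comm _ (1 : ℝ≥0∞)] at h
    exact (ENNReal.add_left_inj (ENNReal.mul_ne_top ENNReal.coe_ne_top
      (ne_top_of_le_ne_top ENNReal.one_ne_top hlo))).1 h
  have hm₀ : q₀ ∈ bandClass μ lo₀ up₀ := by
    refine ⟨hq₀.1, hq₀.2.1, ?_⟩
    filter_upwards [hq₀.2.2, h₀.lo_le_up] with ω hb hle
    exact ⟨(le_clip hle).trans hb.1, hb.2.trans clip_le⟩
  have hm₁ : q₁ ∈ bandClass μ lo₁ up₁ := by
    refine ⟨mq₁, hint, ?_⟩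
    filter_upwards [hq₀.2.2, h₁.lo_le_up, hpair] with ω hb hle hp
    by_cases hlt : a₀ ω < q₀ ω
    · simp only [hq₁, if_pos hlt]
      refine ⟨?_, ?_⟩
      · calc lo₁ ω ≤ a₁ ω := le_clip hle
          _ = v * a₀ ω := (hp hlt).1.symm
          _ ≤ v * q₀ ω := mul_le_mul_right hb.1 _
      · calc v * q₀ ω ≤ v * A₀ ω := mul_le_mul_right hb.2 _
          _ = clip (lo₁ ω) (up₁ ω) (v * up₀ ω) := (hp hlt).2
          _ ≤ up₁ ω := clip_le
    · simp only [hq₁, if_neg hlt]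
      exact ⟨le_clip hle, clip_le⟩
  refine ⟨q₀, hm₀, q₁, hm₁, 1, mixCoeff u, mixCoeff v,
    solvesBandEquations_mixCoeff (by exact_mod_cast hu) (by exact_mod_cast hv) hm₀ hm₁ ?_,
    Or.inl (mixCoeff_mul_mixCoeff_le huv.le)⟩
  filter_upwards [h₀.lo_le_up, h₁.lo_le_up, hq₀.2.2] with ω hω₀ hω₁ hb
  by_cases hlt : a₀ ω < q₀ ω
  · have huv' : (u : ℝ≥0∞) * v = 1 := by exact_mod_cast huv
    have e : u * (v * q₀ ω) = q₀ ω := by rw [← mul_assoc, huv', one_mul]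
    simp only [hq₁, if_pos hlt, e]
    exact ⟨⟨fun h => absurd h (lt_irrefl _), fun _ h => absurd h (lt_irrefl _)⟩,
      fun h => absurd h (lt_irrefl _), fun _ h => absurd h (lt_irrefl _)⟩
  · simp only [hq₁, if_neg hlt, le_antisymm (not_lt.1 hlt) hb.1]
    have a := lower_pair huv.le hω₀ hω₁
    have b := lower_pair hvu.le hω₁ hω₀
    exact ⟨⟨a.1, fun _ => a.2⟩, b.1, fun _ => b.2⟩

/-- In the notation above, `A₁ - v A₀ ≤ a₁ - v a₀` in mass. Where `a₁ < A₁` the segments correspond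
under scaling and equality holds; elsewhere `a₀ ≤ A₀` is enough. The sums avoid subtraction in
`ℝ≥0∞`. -/
theorem clipMass_upper_add_le (h₀ : IsDensityBand μ lo₀ up₀)
    (h₁ : IsDensityBand μ lo₁ up₁) {u v : ℝ≥0} (huv : u * v = 1) :
    clipMass μ lo₁ up₁ up₀ v + v * clipMass μ lo₀ up₀ lo₁ u ≤
      clipMass μ lo₁ up₁ lo₀ v + v * clipMass μ lo₀ up₀ up₁ u := by
  have huv' : (v : ℝ≥0∞) * u = 1 := by
    rw [mul_comm]
    exact_mod_cast huv
  have hvu (x : ℝ≥0∞) : v * (u * x) = x := by rw [← mul_assoc, huv', one_mul]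
  unfold clipMass
  rw [← lintegral_const_mul' _ _ ENNReal.coe_ne_top, ← lintegral_const_mul' _ _ ENNReal.coe_ne_top,
    ← lintegral_add_left (measurable_clip h₁.measurable_lo h₁.measurable_up
      (h₀.measurable_up.const_mul _)),
    ← lintegral_add_left (measurable_clip h₁.measurable_lo h₁.measurable_up
      (h₀.measurable_lo.const_mul _))]
  refine lintegral_mono_ae ?_
  filter_upwards [h₀.lo_le_up, h₁.lo_le_up] with ω hω₀ hω₁
  by_cases hlt : clip (lo₁ ω) (up₁ ω) (v * lo₀ ω) < clip (lo₁ ω) (up₁ ω) (v * up₀ ω)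
  · obtain ⟨e1, e2⟩ := mul_eq_clip_of_lt huv hω₁ hlt
    rw [← e1, ← e2, hvu, hvu, add_comm]
  · gcongr ?_ + _ * ?_
    · exact not_lt.1 hlt
    · exact clip_mono (mul_le_mul_right hω₁ _)

theorem exists_balanced_factor (h₀ : IsDensityBand μ lo₀ up₀) (h₁ : IsDensityBand μ lo₁ up₁)
    (hl₀ : ∫⁻ ω, lo₀ ω ∂μ < 1) (hl₁ : ∫⁻ ω, lo₁ ω ∂μ < 1) :
    ∃ u : ℝ≥0, 0 < u ∧
      clipMass μ lo₁ up₁ lo₀ u⁻¹ + (u⁻¹ : ℝ≥0) =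
        (u⁻¹ : ℝ≥0) * clipMass μ lo₀ up₀ lo₁ u + 1 := by
  obtain ⟨a, ha, hma⟩ := exists_clipMass_add_le_one (up := up₀) h₀.measurable_lo
    h₁.lintegral_lo_le_one hl₀
  obtain ⟨b, hb, hmb⟩ := exists_clipMass_add_le_one (up := up₁) h₁.measurable_lo
    h₀.lintegral_lo_le_one hl₁
  replace hma := hma a le_rfl
  replace hmb := hmb b le_rfl
  have hfin₀ (u : ℝ≥0) : clipMass μ lo₀ up₀ lo₁ u ≠ ∞ :=
    clipMass_ne_top h₀.measurable_lo h₀.measurable_up h₁.measurable_lo ha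
      (ne_top_of_le_ne_top ENNReal.one_ne_top (le_self_add.trans hma))
  have hfin₁ (u : ℝ≥0) : clipMass μ lo₁ up₁ lo₀ u ≠ ∞ :=
    clipMass_ne_top h₁.measurable_lo h₁.measurable_up h₀.measurable_lo hb
      (ne_top_of_le_ne_top ENNReal.one_ne_top (le_self_add.trans hmb))
  have ha1 : a ≤ 1 := by exact_mod_cast le_add_self.trans hma
  have hb1 : b ≤ 1 := by exact_mod_cast le_add_self.trans hmb
  have hab : a ≤ b⁻¹ := ha1.trans ((one_le_inv₀ hb).2 hb1)
  have hpos {u : ℝ≥0} (hu : u ∈ Set.Icc a b⁻¹) : 0 < u := ha.trans_le hu.1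
  have hinv : ContinuousOn (fun u : ℝ≥0 => u⁻¹) (Set.Icc a b⁻¹) :=
    continuousOn_id.inv₀ fun u hu => (hpos hu).ne'
  have hc₀ := (continuousOn_clipMass h₀.measurable_lo h₀.measurable_up h₁.measurable_lo ha
    (hfin₀ a)).mono (Set.Icc_subset_Ici_self : Set.Icc a b⁻¹ ⊆ _)
  have hc₁ := (continuousOn_clipMass h₁.measurable_lo h₁.measurable_up h₀.measurable_lo hb
    (hfin₁ b)).comp hinv fun u hu => (le_inv_comm₀ (hpos hu) hb).1 hu.2
  have hg : ContinuousOn (fun u : ℝ≥0 => (clipMass μ lo₁ up₁ lo₀ u⁻¹).toReal + (u⁻¹ : ℝ≥0) -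
      ((u⁻¹ : ℝ≥0) * (clipMass μ lo₀ up₀ lo₁ u).toReal + 1)) (Set.Icc a b⁻¹) := by
    have hinv' := NNReal.continuous_coe.comp_continuousOn hinv
    exact (hc₁.add hinv').sub ((hinv'.mul hc₀).add continuousOn_const)
  have hma' : (clipMass μ lo₀ up₀ lo₁ a).toReal + a ≤ 1 := by
    simpa [ENNReal.toReal_add (hfin₀ a)] using ENNReal.toReal_mono ENNReal.one_ne_top hma
  have hmb' : (clipMass μ lo₁ up₁ lo₀ b).toReal + b ≤ 1 := by
    simpa [ENNReal.toReal_add (hfin₁ b)] using ENNReal.toReal_mono ENNReal.one_ne_top hmb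
  -- At `u⁻¹ = b` the left side of the balance is at most `1`; at `u = a` the right side is at most
  -- `a⁻¹`, already a summand on the left.
  have hzero : (0 : ℝ) ∈ Set.Icc
      ((clipMass μ lo₁ up₁ lo₀ b⁻¹⁻¹).toReal + (b⁻¹⁻¹ : ℝ≥0) -
        ((b⁻¹⁻¹ : ℝ≥0) * (clipMass μ lo₀ up₀ lo₁ b⁻¹).toReal + 1))
      ((clipMass μ lo₁ up₁ lo₀ a⁻¹).toReal + (a⁻¹ : ℝ≥0) -
        ((a⁻¹ : ℝ≥0) * (clipMass μ lo₀ up₀ lo₁ a).toReal + 1)) := by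
    constructor
    · rw [inv_inv]
      have : 0 ≤ (b : ℝ) * (clipMass μ lo₀ up₀ lo₁ b⁻¹).toReal :=
        mul_nonneg b.2 ENNReal.toReal_nonneg
      linarith
    · have h1 : (a⁻¹ : ℝ≥0) * (a : ℝ) = 1 := by exact_mod_cast inv_mul_cancel₀ ha.ne'
      have h2 : (0 : ℝ) ≤ (a⁻¹ : ℝ≥0) := (a⁻¹).2
      have h3 : (0 : ℝ) ≤ (clipMass μ lo₁ up₁ lo₀ a⁻¹).toReal := ENNReal.toReal_nonneg
      nlinarith [mul_le_mul_of_nonneg_left hma' h2]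
  obtain ⟨u, hu, hroot⟩ := intermediate_value_Icc' hab hg hzero
  refine ⟨u, hpos hu, ?_⟩
  have hroot' := sub_eq_zero.1 hroot
  refine (ENNReal.toReal_eq_toReal_iff' ?_ ?_).1 ?_
  · exact ENNReal.add_ne_top.2 ⟨hfin₁ _, ENNReal.coe_ne_top⟩
  · exact ENNReal.add_ne_top.2
      ⟨ENNReal.mul_ne_top ENNReal.coe_ne_top (hfin₀ _), ENNReal.one_ne_top⟩
  · rw [ENNReal.toReal_add (hfin₁ _) ENNReal.coe_ne_top,
      ENNReal.toReal_add (ENNReal.mul_ne_top ENNReal.coe_ne_top (hfin₀ _)) ENNReal.one_ne_top,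
      ENNReal.toReal_mul]
    exact hroot'

theorem exists_clipMass_eq_one_of_one_le {lo up f : Ω → ℝ≥0∞} (hb : IsDensityBand μ lo up)
    (hf : Measurable f) (hf1 : ∫⁻ ω, f ω ∂μ ≤ 1) (hl : ∫⁻ ω, lo ω ∂μ < 1) {u : ℝ≥0} (hu : 0 < u)
    (h : 1 ≤ clipMass μ lo up f u) : ∃ w, 0 < w ∧ w ≤ u ∧ clipMass μ lo up f w = 1 := by
  obtain ⟨δ, hδ, hle⟩ := exists_clipMass_add_le_one (up := up) hb.measurable_lo hf1 hl
  obtain ⟨w, hw, hw1⟩ := exists_clipMass_eq_one hb.measurable_lo hb.measurable_up hf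
    (lt_min hδ hu) (min_le_right δ u) (le_self_add.trans (hle _ (min_le_left _ _))) h
  exact ⟨w, (lt_min hδ hu).trans_le hw.1, hw.2, hw1⟩

theorem solvable_of_lintegral_lt_one [SigmaFinite μ] (h₀ : IsDensityBand μ lo₀ up₀)
    (h₁ : IsDensityBand μ lo₁ up₁) (hl₀ : ∫⁻ ω, lo₀ ω ∂μ < 1) (hl₁ : ∫⁻ ω, lo₁ ω ∂μ < 1) :
    BandEquationsSolvable μ lo₀ up₀ lo₁ up₁ := by
  obtain ⟨u, hu, hbal⟩ := exists_balanced_factor h₀ h₁ hl₀ hl₁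
  set v := u⁻¹ with hv
  have hv0 : 0 < v := inv_pos.2 hu
  have huv : u * v = 1 := mul_inv_cancel₀ hu.ne'
  rcases le_total 1 (clipMass μ lo₀ up₀ lo₁ u) with hm | hm
  · have hn : 1 ≤ clipMass μ lo₁ up₁ lo₀ v := by
      refine (ENNReal.add_le_add_iff_right (ENNReal.coe_ne_top (r := v))).1 ?_
      rw [hbal, add_comm]
      gcongr
      exact le_mul_of_one_le_right' hm
    obtain ⟨u', hu', hle, hu1⟩ :=
      exists_clipMass_eq_one_of_one_le h₀ h₁.measurable_lo h₁.lintegral_lo_le_one hl₀ hu hm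
    obtain ⟨v', hv', hle', hv1⟩ :=
      exists_clipMass_eq_one_of_one_le h₁ h₀.measurable_lo h₀.lintegral_lo_le_one hl₁ hv0 hn
    exact solvable_of_clipMass_lower_eq_one h₀ h₁ hu' hv' ((mul_le_mul' hle hle').trans huv.le)
      hu1 hv1
  · rcases le_total 1 (clipMass μ lo₀ up₀ up₁ u) with hM | hM
    · exact solvable_of_clipMass_le_one_le h₀ h₁ huv hbal hm hM
    · refine solvable_of_clipMass_upper_le_one h₀ h₁ hu hv0 huv.ge hM ?_
      have hfin : (v : ℝ≥0∞) * clipMass μ lo₀ up₀ lo₁ u ≠ ∞ :=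
        ENNReal.mul_ne_top ENNReal.coe_ne_top (ne_top_of_le_ne_top ENNReal.one_ne_top hm)
      refine (ENNReal.add_le_add_iff_right hfin).1 ?_
      calc _ ≤ clipMass μ lo₁ up₁ lo₀ v + v * clipMass μ lo₀ up₀ up₁ u :=
            clipMass_upper_add_le h₀ h₁ huv
        _ ≤ clipMass μ lo₁ up₁ lo₀ v + v * 1 := by gcongr
        _ = 1 + v * clipMass μ lo₀ up₀ lo₁ u := by rw [mul_one, hbal, add_comm]

theorem clipMass_eq_one_of_ae_eq {lo up f : Ω → ℝ≥0∞} (hb : IsDensityBand μ lo up)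
    (h : lo =ᵐ[μ] up) (u : ℝ≥0) : clipMass μ lo up f u = 1 := by
  have h1 : ∫⁻ ω, lo ω ∂μ = 1 :=
    le_antisymm hb.lintegral_lo_le_one (lintegral_congr_ae h ▸ hb.one_le_lintegral_up)
  rw [← h1]
  refine lintegral_congr_ae ?_
  filter_upwards [h] with ω hω
  rw [← hω, clip_self]

theorem exists_clipMass_le_one_of_ae_eq {lo up f F : Ω → ℝ≥0∞} (hb : IsDensityBand μ lo up)
    (hB : IsDensityBand μ f F) (h : f =ᵐ[μ] F)
    (hlo : ∫⁻ ω, lo ω ∂μ < 1 ∨ lo =ᵐ[μ] up) :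
    ∃ u, 0 < u ∧ clipMass μ lo up F u ≤ 1 := by
  rcases hlo with hlo | hlo
  · obtain ⟨δ, hδ, hle⟩ := exists_clipMass_add_le_one (up := up) hb.measurable_lo
      (lintegral_congr_ae h ▸ hB.lintegral_lo_le_one) hlo
    exact ⟨δ, hδ, le_self_add.trans (hle δ le_rfl)⟩
  · exact ⟨1, one_pos, (clipMass_eq_one_of_ae_eq hb hlo 1).le⟩

theorem bandEquationsSolvable [SigmaFinite μ] (h₀ : IsDensityBand μ lo₀ up₀)
    (h₁ : IsDensityBand μ lo₁ up₁) (hd₀ : ∫⁻ ω, lo₀ ω ∂μ < 1 ∨ lo₀ =ᵐ[μ] up₀)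
    (hd₁ : ∫⁻ ω, lo₁ ω ∂μ < 1 ∨ lo₁ =ᵐ[μ] up₁) :
    BandEquationsSolvable μ lo₀ up₀ lo₁ up₁ := by
  rcases hd₀ with hl₀ | he₀
  · rcases hd₁ with hl₁ | he₁
    · exact solvable_of_lintegral_lt_one h₀ h₁ hl₀ hl₁
    -- A degenerate band has truncated mass one for every factor, so only the other factor has to be
    -- made small and its inverse is admissible.
    · obtain ⟨u, hu, hu1⟩ := exists_clipMass_le_one_of_ae_eq h₀ h₁ he₁ (Or.inl hl₀)
      exact solvable_of_clipMass_upper_le_one h₀ h₁ hu (inv_pos.2 hu) (mul_inv_cancel₀ hu.ne').ge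
        hu1 (clipMass_eq_one_of_ae_eq h₁ he₁ _).le
  · obtain ⟨v, hv, hv1⟩ := exists_clipMass_le_one_of_ae_eq h₁ h₀ he₀ hd₁
    exact solvable_of_clipMass_upper_le_one h₀ h₁ (inv_pos.2 hv) hv (inv_mul_cancel₀ hv.ne').ge
      (clipMass_eq_one_of_ae_eq h₀ he₀ _).le hv1

end Existence

theorem theorem4 {Ω : Type*} [MeasurableSpace Ω] (μ : Measure Ω) [SigmaFinite μ]
    (lo₀ up₀ lo₁ up₁ : Ω → ℝ≥0∞)
    (h₀ : IsDensityBand μ lo₀ up₀) (h₁ : IsDensityBand μ lo₁ up₁) :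
    -- every solution dominates where the ratio is defined, and is least favorable
    -- on the whole space as soon as its common zeros are nondegenerate
    (∀ q₀ ∈ bandClass μ lo₀ up₀, ∀ q₁ ∈ bandClass μ lo₁ up₁, ∀ α c₀ c₁ : ℝ≥0,
      SolvesBandEquations μ lo₀ up₀ lo₁ up₁ α c₀ c₁ q₀ q₁ →
        StochasticDominanceOn μ (bandClass μ lo₀ up₀) (bandClass μ lo₁ up₁) q₀ q₁
            (fun ω => q₁ ω / q₀ ω) {ω | q₀ ω ≠ 0 ∨ q₁ ω ≠ 0} ∧
          (NondegenerateZeros μ up₀ up₁ α c₀ c₁ q₀ q₁ →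
            IsLeastFavorable μ (bandClass μ lo₀ up₀) (bandClass μ lo₁ up₁) q₀ q₁)) ∧
    -- existence
    ((∫⁻ ω, lo₀ ω ∂μ < 1 ∨ lo₀ =ᵐ[μ] up₀) → (∫⁻ ω, lo₁ ω ∂μ < 1 ∨ lo₁ =ᵐ[μ] up₁) →
      ∃ q₀ ∈ bandClass μ lo₀ up₀, ∃ q₁ ∈ bandClass μ lo₁ up₁, ∃ α c₀ c₁ : ℝ≥0,
        SolvesBandEquations μ lo₀ up₀ lo₁ up₁ α c₀ c₁ q₀ q₁ ∧
          NondegenerateZeros μ up₀ up₁ α c₀ c₁ q₀ q₁ ∧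
          IsLeastFavorable μ (bandClass μ lo₀ up₀) (bandClass μ lo₁ up₁) q₀ q₁) := by
  refine ⟨fun q₀ hq₀ q₁ hq₁ α c₀ c₁ hsol =>
    ⟨stochasticDominanceOn_quotient h₀ h₁ hq₀ hq₁ hsol,
      isLeastFavorable_of_solvesBandEquations h₀ h₁ hq₀ hq₁ hsol⟩, fun hd₀ hd₁ => ?_⟩
  obtain ⟨q₀, hq₀, q₁, hq₁, α, c₀, c₁, hsol, hN⟩ := bandEquationsSolvable h₀ h₁ hd₀ hd₁
  exact ⟨q₀, hq₀, q₁, hq₁, α, c₀, c₁, hsol, hN,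
    isLeastFavorable_of_solvesBandEquations h₀ h₁ hq₀ hq₁ hsol hN⟩
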